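/- Let $e,h,\Omega>0$, $\hbar=h/2\pi$, and $\mathcal T\in[0,1]$. For $n\in\mathbb Z$ let $J_n$ be the Bessel function of order $n$, let $\mathrm{Ai}$ be the Airy function, and for $A\ge 0$, $\nu,\lambda\in\mathbb Z$, $s,t\in\mathbb R$ put $$K_A(\nu,\lambda)=\sum_{r=0}^\infty J_{\nu+r}(A)J_{\lambda+r}(A),\qquad K_{\mathrm{Ai}}(s,t)=\int_0^\infty \mathrm{Ai}(s+u)\,\mathrm{Ai}(t+u)\,du,\qquad \kappa_A=(A/2)^{1/3}.$$ Consider the zero-temperature photo-assisted shot noise of a single channel with energy-independent transmission $\mathcal T$ under a monochromatic drive of amplitude $A$, as a function of the bias $V$, $$S_I(V)=\frac{2e^2}{h}\,\mathcal T(1-\mathcal T)\sum_{n\in\mathbb Z}J_n(A)^2\,|eV+n\hbar\Omega| ,$$ and its plateau deficit $$\Delta_I(V)=\frac{2e^3}{h}\,\mathcal T(1-\mathcal T)-\frac{dS_I}{dV}(V).$$ The sums defining $S_I$ and $K_A$ and the integral defining $K_{\mathrm{Ai}}(s,s)$ converge absolutely, and the following hold. (1) For every $A\ge 0$ and every $V>0$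 with $eV/\hbar\Omega\notin\mathbb Z$, $S_I$ is differentiable at $V$ and, with $\nu_V=\lceil eV/\hbar\Omega\rceil$, $$\Delta_I(V)=\frac{4e^3}{h}\,\mathcal T(1-\mathcal T)\,K_A(\nu_V,\nu_V).$$ Moreover $\frac{dS_I}{dV}(V)\to\frac{2e^3}{h}\mathcal T(1-\mathcal T)$ as $V\to+\infty$ through such values. (2) Let $s\in\mathbb R$, and for each $A$ let the bias $V=V(A)$ be chosen so that, for all sufficiently large $A$, $eV/\hbar\Omega\notin\mathbb Z$ and $\nu_V=\lfloor A+s\kappa_A\rfloor$. Then $$\kappa_A\,\Delta_I(V)\longrightarrow\frac{4e^3}{h}\,\mathcal T(1-\mathcal T)\,K_{\mathrm{Ai}}(s,s)\qquad\text{as }A\to\infty .$$ -/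

import Mathlib

open Filter Topology MeasureTheory

namespace ShotNoise

noncomputable section

/-- The Bessel function `J_n(A)` of integer order, by Bessel's integral: the (real) `n`-th Fourier
coefficient of the drive's phase factor `θ ↦ exp (i A sin θ)`. -/
def besselJ (n : ℤ) (A : ℝ) : ℝ :=
  (1 / (2 * Real.pi)) * ∫ θ in (-Real.pi)..Real.pi, Real.cos (n * θ - A * Real.sin θ)

/-- The Airy function
`Ai(x) = (1 / 2π) ∫_{Im ζ = η} exp (i (ζ ^ 3 / 3 + x ζ)) dζ` on the real line. The integral
converges absolutely for every `η > 0` and does not depend on `η`; here `η = 1`. It is real, so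
that taking the real part changes nothing. -/
def airyAi (x : ℝ) : ℝ :=
  ((1 / (2 * Real.pi) : ℂ) *
    ∫ t : ℝ, Complex.exp (Complex.I *
      (((t : ℂ) + Complex.I) ^ 3 / 3 + (x : ℂ) * ((t : ℂ) + Complex.I)))).re

/-- The Airy kernel `K_Ai(s, t) = ∫_0^∞ Ai(s + u) Ai(t + u) du`. -/
def airyKernel (s t : ℝ) : ℝ :=
  ∫ u in Set.Ioi (0 : ℝ), airyAi (s + u) * airyAi (t + u)

/-- The discrete Bessel kernel `K_A(ν, l) = ∑_{r ≥ 0} J_{ν + r}(A) J_{l + r}(A)`. -/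
def discreteBesselKernel (A : ℝ) (ν l : ℤ) : ℝ :=
  ∑' r : ℕ, besselJ (ν + r) A * besselJ (l + r) A

/-- The edge scale `κ_A = (A / 2) ^ (1 / 3)`. -/
def edgeScale (A : ℝ) : ℝ := (A / 2) ^ (1 / 3 : ℝ)

/-- The edge index `ν_A(s) = ⌊A + s κ_A⌋`. -/
def edgeIndex (A s : ℝ) : ℤ := ⌊A + s * edgeScale A⌋

/-- The reduced Planck constant. -/
def hbar (h : ℝ) : ℝ := h / (2 * Real.pi)

/-- The bias in units of the photon energy, `x = e V / (ħ Ω)`. -/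
def reducedBias (e h Ω V : ℝ) : ℝ := e * V / (hbar h * Ω)

/-- The bias `V` is not at a slope discontinuity: `e V / (ħ Ω)` is not an integer. -/
def OffStep (e h Ω V : ℝ) : Prop := ∀ n : ℤ, reducedBias e h Ω V ≠ n

/-- `ν_V = ⌈e V / (ħ Ω)⌉`. -/
def biasIndex (e h Ω V : ℝ) : ℤ := ⌈reducedBias e h Ω V⌉

/-- The zero-temperature photo-assisted partition noise of a single spinless channel with
transmission `T`, driven with dimensionless amplitude `A` at angular frequency `Ω`:
`S_I(V) = (2 e² / h) T (1 - T) ∑_{n ∈ ℤ} J_n(A)² |e V + n ħ Ω|`. -/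
def shotNoise (e h Ω T A V : ℝ) : ℝ :=
  (2 * e ^ 2 / h) * T * (1 - T) *
    ∑' n : ℤ, besselJ n A ^ 2 * |e * V + n * (hbar h * Ω)|

/-- The plateau value `(2 e³ / h) T (1 - T)` of the slope. -/
def plateauSlope (e h T : ℝ) : ℝ := (2 * e ^ 3 / h) * T * (1 - T)

/-- The plateau deficit `Δ_I(V) = (2 e³ / h) T (1 - T) - dS_I/dV`. -/
def plateauDeficit (e h Ω T A V : ℝ) : ℝ :=
  plateauSlope e h T - deriv (shotNoise e h Ω T A) V

end

end ShotNoise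

/-! Between consecutive integers of `x = eV/(ħΩ)` no `x + n` changes sign, so the noise is affine in
the bias there, with slope the plateau value times `∑ Jₙ² sgn(x + n)`. Parseval gives `∑ Jₙ² = 1`;
the negative terms are those with `n ≤ -⌈x⌉`, and since `J₋ₙ² = Jₙ²` they add up to the diagonal
kernel at `⌈x⌉`. The slope is thus plateau times `1 - 2K`. As `K` is a tail of a convergent series,
it vanishes at large bias.

For the edge limit write `A = 2κ³`. Then `κ K` is exactly the integral of a squared step function
with values `κ Jₙ(A)`, and dominated convergence applies given two facts: `κ Jₙ(A) → Ai(x)` when `(n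
- A)/κ → x` (`tendsto_edgeScale_mul_besselJ`), and a uniform bound `C exp(-(n - A)/κ)`
(`exists_abs_edgeScale_mul_besselJ_le`). Both come from raising the contour in Bessel's integral to
height `1/κ`: there the rescaled integrand has a Gaussian majorant uniform in `κ`, and `z - sin z ≈
z³/6` produces the Airy phase. -/

namespace ShotNoise

/-! ### Bessel functions of integer order -/

open Real in
theorem ofReal_besselJ (n : ℤ) (A : ℝ) :
    (besselJ n A : ℂ) = (1 / (2 * π) : ℂ) *
      ∫ θ in (-π)..π, Complex.exp (Complex.I * (n * θ - A * Complex.sin θ)) := by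
  have hexp : ∀ θ : ℝ, Complex.exp (Complex.I * (n * θ - A * Complex.sin θ)) =
      (cos (n * θ - A * sin θ) : ℝ) + (sin (n * θ - A * sin θ) : ℝ) * Complex.I := by
    intro θ
    rw [mul_comm, Complex.exp_mul_I]
    push_cast
    rfl
  have hodd : ∫ θ in (-π)..π, sin (n * θ - A * sin θ) = 0 := by
    have h := intervalIntegral.integral_comp_neg (a := -π) (b := π)
      (fun θ : ℝ => sin (n * θ - A * sin θ))
    have h2 : (fun θ : ℝ => sin (n * (-θ) - A * sin (-θ))) =
        fun θ : ℝ => -sin (n * θ - A * sin θ) := by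
      ext θ
      rw [← sin_neg, sin_neg θ]
      ring_nf
    simp only [neg_neg] at h
    rw [h2, intervalIntegral.integral_neg] at h
    linarith
  simp_rw [hexp]
  rw [intervalIntegral.integral_add, intervalIntegral.integral_mul_const,
    intervalIntegral.integral_ofReal, intervalIntegral.integral_ofReal, hodd, besselJ]
  · push_cast
    ring
  · exact Continuous.intervalIntegrable (by fun_prop) _ _
  · exact Continuous.intervalIntegrable (by fun_prop) _ _

-- The substitution `θ ↦ π - θ` and periodicity give `J₋ₙ = cos(nπ) Jₙ`, and `cos(nπ)² = 1`.
open Real in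
theorem besselJ_neg_sq (n : ℤ) (A : ℝ) : besselJ (-n) A ^ 2 = besselJ n A ^ 2 := by
  have h : besselJ (-n) A = cos (n * π) * besselJ n A := by
    have hper : Function.Periodic (fun θ : ℝ => cos (n * θ - A * sin θ)) (2 * π) := by
      intro θ
      have : (n * (θ + 2 * π) - A * sin (θ + 2 * π) : ℝ) = n * θ - A * sin θ + n * (2 * π) := by
        rw [sin_add_two_pi]; ring
      simp only [this, cos_add_int_mul_two_pi]
    have h1 := hper.intervalIntegral_add_eq (-π) 0
    have h2 := intervalIntegral.integral_comp_sub_left (a := -π) (b := π)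
      (fun φ : ℝ => cos (-n * (π - φ) - A * sin (π - φ))) π
    have h3 : ∀ φ : ℝ, cos (-n * (π - φ) - A * sin (π - φ)) =
        cos (n * π) * cos (n * φ - A * sin φ) := by
      intro φ
      have : (-n * (π - φ) - A * sin (π - φ) : ℝ) = (n * φ - A * sin φ) - n * π := by
        rw [sin_pi_sub]; ring
      rw [this, cos_sub, sin_int_mul_pi]
      ring
    simp only [sub_sub_cancel, h3, intervalIntegral.integral_const_mul] at h2
    rw [besselJ, besselJ]
    push_cast
    rw [h2]
    rw [show -π + 2 * π = π by ring, zero_add] at h1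
    rw [h1, show π - -π = 2 * π by ring, sub_self]
    ring
  have hc : cos (n * π) ^ 2 = 1 := by
    have := sin_sq_add_cos_sq (n * π)
    rw [sin_int_mul_pi] at this
    linarith
  rw [h, mul_pow, hc, one_mul]

-- Parseval for the unimodular function `exp(-iA sin θ)`, whose `n`-th Fourier coefficient is
-- `J₋ₙ(A)`.
open Real in
theorem hasSum_besselJ_sq (A : ℝ) : HasSum (fun n : ℤ => besselJ n A ^ 2) 1 := by
  have hlt : -π < π := by linarith [pi_pos]
  set f : ℝ → ℂ := fun θ => Complex.exp (-(A * sin θ : ℝ) * Complex.I) with hf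
  have hcont : Continuous f := by fun_prop
  have hnorm : ∀ θ, ‖f θ‖ = 1 := by
    intro θ
    have := Complex.norm_exp_ofReal_mul_I (-(A * sin θ))
    rwa [Complex.ofReal_neg] at this
  have hL2 : MemLp f 2 (volume.restrict (Set.Ioc (-π) π)) :=
    MemLp.of_bound hcont.aestronglyMeasurable 1 (ae_of_all _ fun θ => (hnorm θ).le)
  have h := hasSum_sq_fourierCoeffOn hlt hL2
  have hcoef : ∀ n : ℤ, ‖fourierCoeffOn hlt f n‖ ^ 2 = besselJ n A ^ 2 := by
    intro n
    rw [← besselJ_neg_sq]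
    have : fourierCoeffOn hlt f n = (besselJ (-n) A : ℂ) := by
      rw [ofReal_besselJ, fourierCoeffOn_eq_integral, ← Complex.coe_smul, smul_eq_mul]
      congr 1
      · push_cast; ring
      · refine intervalIntegral.integral_congr fun θ _ => ?_
        simp only [hf, fourier_coe_apply, smul_eq_mul]
        rw [← Complex.exp_add]
        congr 1
        have : (π : ℂ) ≠ 0 := by exact_mod_cast pi_ne_zero
        push_cast
        field_simp
        ring
    rw [this, Complex.norm_real, norm_eq_abs, sq_abs]
  have hval : (π - -π)⁻¹ • ∫ x in (-π)..π, ‖f x‖ ^ 2 = 1 := by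
    simp only [hnorm, one_pow, intervalIntegral.integral_const, smul_eq_mul, mul_one]
    exact inv_mul_cancel₀ (by linarith)
  rw [hval] at h
  simpa only [hcoef] using h

theorem summable_besselJ_sq (A : ℝ) : Summable fun n : ℤ => besselJ n A ^ 2 :=
  (hasSum_besselJ_sq A).summable

-- The derivative of `sin(nθ - A sin θ)` integrates to zero over a period.
open Real in
theorem besselJ_recurrence (n : ℤ) (A : ℝ) :
    n * besselJ n A = A / 2 * (besselJ (n + 1) A + besselJ (n - 1) A) := by
  have hder : ∫ θ in (-π)..π, cos (n * θ - A * sin θ) * (n - A * cos θ) = 0 := by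
    rw [intervalIntegral.integral_eq_sub_of_hasDerivAt
      (f := fun θ : ℝ => sin (n * θ - A * sin θ))]
    · simp only [sin_pi, sin_neg, neg_zero, mul_zero, sub_zero, sin_int_mul_pi, mul_neg]
    · intro θ _
      have h1 : HasDerivAt (fun θ : ℝ => n * θ - A * sin θ) (n - A * cos θ) θ := by
        simpa using ((hasDerivAt_id' θ).const_mul (n : ℝ)).fun_sub ((hasDerivAt_sin θ).const_mul A)
      exact h1.sin
    · exact Continuous.intervalIntegrable (by fun_prop) _ _
  have hsum : (∫ θ in (-π)..π, cos ((n + 1 : ℤ) * θ - A * sin θ)) +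
      ∫ θ in (-π)..π, cos ((n - 1 : ℤ) * θ - A * sin θ) =
      ∫ θ in (-π)..π, 2 * (cos (n * θ - A * sin θ) * cos θ) := by
    rw [← intervalIntegral.integral_add]
    · refine intervalIntegral.integral_congr fun θ _ => ?_
      rw [show ((n + 1 : ℤ) * θ - A * sin θ : ℝ) = (n * θ - A * sin θ) + θ by push_cast; ring,
        show ((n - 1 : ℤ) * θ - A * sin θ : ℝ) = (n * θ - A * sin θ) - θ by push_cast; ring,
        cos_add (_ - _), cos_sub (_ - _)]
      ring
    · exact Continuous.intervalIntegrable (by fun_prop) _ _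
    · exact Continuous.intervalIntegrable (by fun_prop) _ _
  have hsplit : ∫ θ in (-π)..π, cos (n * θ - A * sin θ) * (n - A * cos θ) =
      n * (∫ θ in (-π)..π, cos (n * θ - A * sin θ)) -
        A * ∫ θ in (-π)..π, cos (n * θ - A * sin θ) * cos θ := by
    rw [← intervalIntegral.integral_const_mul, ← intervalIntegral.integral_const_mul,
      ← intervalIntegral.integral_sub]
    · refine intervalIntegral.integral_congr fun θ _ => ?_
      ring
    · exact Continuous.intervalIntegrable (by fun_prop) _ _
    · exact Continuous.intervalIntegrable (by fun_prop) _ _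
  rw [intervalIntegral.integral_const_mul] at hsum
  rw [hder] at hsplit
  simp only [besselJ]
  rw [← mul_add, hsum]
  linear_combination (-1 / (2 * π)) * hsplit

/-- By the recurrence, `n² Jₙ²` is controlled by the squares of the two neighbours, and `|n| ≤ n²`
on the integers. -/
theorem summable_abs_mul_besselJ_sq (A : ℝ) :
    Summable fun n : ℤ => |(n : ℝ)| * besselJ n A ^ 2 := by
  have h1 : Summable fun n : ℤ => besselJ (n + 1) A ^ 2 :=
    (summable_besselJ_sq A).comp_injective (add_left_injective (1 : ℤ))
  have h2 : Summable fun n : ℤ => besselJ (n - 1) A ^ 2 :=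
    (summable_besselJ_sq A).comp_injective (sub_left_injective (b := (1 : ℤ)))
  refine Summable.of_nonneg_of_le (fun n => by positivity) (fun n => ?_)
    ((h1.add h2).mul_left (A ^ 2 / 2))
  have habs : |(n : ℝ)| ≤ (n : ℝ) ^ 2 := by
    have : |n| ≤ n ^ 2 := by simpa using Int.natAbs_le_self_sq n
    exact_mod_cast this
  calc |(n : ℝ)| * besselJ n A ^ 2 ≤ (n : ℝ) ^ 2 * besselJ n A ^ 2 := by gcongr
    _ = (A / 2) ^ 2 * (besselJ (n + 1) A + besselJ (n - 1) A) ^ 2 := by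
      rw [← mul_pow, besselJ_recurrence, mul_pow]
    _ ≤ (A / 2) ^ 2 * (2 * (besselJ (n + 1) A ^ 2 + besselJ (n - 1) A ^ 2)) := by
      gcongr
      nlinarith [sq_nonneg (besselJ (n + 1) A - besselJ (n - 1) A)]
    _ = A ^ 2 / 2 * (besselJ (n + 1) A ^ 2 + besselJ (n - 1) A ^ 2) := by ring

/-! ### The noise series and the discrete Bessel kernel -/

theorem summable_besselJ_sq_mul_abs (A a b : ℝ) :
    Summable fun n : ℤ => besselJ n A ^ 2 * |a + n * b| := by
  refine Summable.of_nonneg_of_le (fun n => by positivity) (fun n => ?_)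
    (((summable_besselJ_sq A).mul_left |a|).add ((summable_abs_mul_besselJ_sq A).mul_left |b|))
  calc besselJ n A ^ 2 * |a + n * b| ≤ besselJ n A ^ 2 * (|a| + |(n : ℝ)| * |b|) := by
        gcongr
        rw [← abs_mul]
        exact abs_add_le _ _
    _ = _ := by ring

theorem summable_besselJ_shift_sq (A : ℝ) (ν : ℤ) :
    Summable fun r : ℕ => besselJ (ν + r) A ^ 2 :=
  (summable_besselJ_sq A).comp_injective
    (i := fun r : ℕ => ν + r) (fun a b h => by simpa using h)

theorem summable_besselJ_mul_besselJ (A : ℝ) (ν l : ℤ) :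
    Summable fun r : ℕ => besselJ (ν + r) A * besselJ (l + r) A := by
  refine Summable.of_norm_bounded
    ((summable_besselJ_shift_sq A ν).add (summable_besselJ_shift_sq A l)) fun r => ?_
  rw [Real.norm_eq_abs, abs_le]
  constructor <;>
  nlinarith [sq_nonneg (besselJ (ν + r) A + besselJ (l + r) A),
    sq_nonneg (besselJ (ν + r) A - besselJ (l + r) A),
    sq_nonneg (besselJ (ν + r) A), sq_nonneg (besselJ (l + r) A)]

theorem discreteBesselKernel_self (A : ℝ) (ν : ℤ) :
    discreteBesselKernel A ν ν = ∑' r : ℕ, besselJ (ν + r) A ^ 2 := by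
  simp only [discreteBesselKernel, sq]

theorem tendsto_discreteBesselKernel_atTop (A : ℝ) :
    Tendsto (fun ν : ℤ => discreteBesselKernel A ν ν) atTop (𝓝 0) := by
  have h := tendsto_sum_nat_add (fun r : ℕ => besselJ r A ^ 2)
  have h2 : Tendsto (fun m : ℕ => discreteBesselKernel A m m) atTop (𝓝 0) := by
    refine h.congr fun m => ?_
    rw [discreteBesselKernel_self]
    refine tsum_congr fun r => ?_
    push_cast
    rw [add_comm]
  have h3 : Tendsto Int.toNat atTop atTop :=
    tendsto_atTop.2 fun b => (eventually_ge_atTop (b : ℤ)).mono fun a ha => by omega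
  refine (h2.comp h3).congr' ?_
  filter_upwards [eventually_ge_atTop (0 : ℤ)] with ν hν
  simp [Int.toNat_of_nonneg hν]

/-- The sum `∑ₙ Jₙ(A)² sgn(x + n)`, where `sgn 0 = -1`. -/
theorem hasSum_besselJ_sq_mul_sign (A x : ℝ) :
    HasSum (fun n : ℤ => besselJ n A ^ 2 * (if 0 < x + n then 1 else -1))
      (1 - 2 * discreteBesselKernel A ⌈x⌉ ⌈x⌉) := by
  have hinj : Function.Injective (fun r : ℕ => -(⌈x⌉ + (r : ℤ))) := fun a b h => by simpa using h
  have h1 : HasSum (fun r : ℕ => besselJ (-(⌈x⌉ + (r : ℤ))) A ^ 2)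
      (discreteBesselKernel A ⌈x⌉ ⌈x⌉) := by
    rw [discreteBesselKernel_self]
    simp only [besselJ_neg_sq]
    exact (summable_besselJ_shift_sq A _).hasSum
  -- `g` keeps the terms with `x + n ≤ 0`, i.e. `n = -(⌈x⌉ + r)` with `r ≥ 0`; the signed sum is the
  -- full sum minus twice this one.
  set g : ℤ → ℝ := fun n => if 0 < x + n then 0 else besselJ n A ^ 2 with hg
  have h2 : HasSum g (discreteBesselKernel A ⌈x⌉ ⌈x⌉) := by
    rw [← hinj.hasSum_iff]
    · refine h1.congr_fun ?_
      intro r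
      have : ¬ (0 < x + ((-(⌈x⌉ + (r : ℤ)) : ℤ) : ℝ)) := by
        have := Int.le_ceil x
        push_cast
        have hr : (0 : ℝ) ≤ r := Nat.cast_nonneg r
        linarith
      simp only [hg, Function.comp, if_neg this]
    · intro n hn
      simp only [hg, ite_eq_left_iff, not_lt]
      intro hle
      exfalso
      apply hn
      have h3 : x ≤ ((-n : ℤ) : ℝ) := by push_cast; linarith
      have h4 : ⌈x⌉ ≤ -n := Int.ceil_le.2 h3
      exact ⟨(-n - ⌈x⌉).toNat, by simp only; omega⟩
  refine ((hasSum_besselJ_sq A).sub (h2.mul_left 2)).congr_fun ?_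
  intro n
  simp only [hg]
  split_ifs <;> ring

/-! ### The slope of the shot noise -/

theorem hbar_pos {h : ℝ} (hh : 0 < h) : 0 < hbar h := by
  unfold hbar; positivity

theorem hasDerivAt_shotNoise {e h Ω T A V : ℝ} (he : 0 < e) (hh : 0 < h) (hΩ : 0 < Ω)
    (hV : OffStep e h Ω V) :
    HasDerivAt (shotNoise e h Ω T A)
      (plateauSlope e h T * (1 - 2 * discreteBesselKernel A (biasIndex e h Ω V)
        (biasIndex e h Ω V))) V := by
  set ω := hbar h * Ω with hω
  have hω0 : 0 < ω := mul_pos (hbar_pos hh) hΩ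
  set x := reducedBias e h Ω V with hxdef
  have hsum := hasSum_besselJ_sq_mul_sign A x
  set D := 1 - 2 * discreteBesselKernel A ⌈x⌉ ⌈x⌉ with hD
  have hcont : Continuous fun W : ℝ => reducedBias e h Ω W := by
    unfold reducedBias; fun_prop
  have hlo : (⌈x⌉ : ℝ) - 1 < x := by linarith [Int.ceil_lt_add_one x]
  -- Being off the steps puts `x` strictly inside the unit interval on which all signs are constant.
  have hhi : x < ⌈x⌉ := lt_of_le_of_ne (Int.le_ceil x) (hV _)
  have hmem : ∀ᶠ W in 𝓝 V, reducedBias e h Ω W ∈ Set.Ioo ((⌈x⌉ : ℝ) - 1) ⌈x⌉ :=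
    hcont.continuousAt.eventually (Ioo_mem_nhds hlo hhi)
  have hsign : ∀ y ∈ Set.Ioo ((⌈x⌉ : ℝ) - 1) ⌈x⌉, ∀ n : ℤ,
      |y + n| = (if 0 < x + n then 1 else -1) * (y + n) := by
    intro y hy n
    rcases le_or_gt (1 - ⌈x⌉) n with hn | hn
    · have hn' : (1 : ℝ) - ⌈x⌉ ≤ n := by exact_mod_cast hn
      rw [if_pos (by linarith), abs_of_pos (by linarith [hy.1]), one_mul]
    · have hn' : (n : ℝ) ≤ -⌈x⌉ := by
        have : n ≤ -⌈x⌉ := by omega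
        exact_mod_cast this
      rw [if_neg (by linarith), abs_of_neg (by linarith [hy.2])]
      ring
  have hscale : ∀ (W : ℝ) (n : ℤ), |e * W + n * ω| = ω * |reducedBias e h Ω W + n| := by
    intro W n
    rw [← abs_of_pos hω0, ← abs_mul, abs_of_pos hω0]
    congr 1
    rw [reducedBias, ← hω]
    field_simp
  have hloc : ∀ᶠ W in 𝓝 V, shotNoise e h Ω T A W =
      shotNoise e h Ω T A V + plateauSlope e h T * D * (W - V) := by
    filter_upwards [hmem] with W hW
    have hsW := (summable_besselJ_sq_mul_abs A (e * W) ω).hasSum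
    have hsV := (summable_besselJ_sq_mul_abs A (e * V) ω).hasSum
    have hdiff := hsW.sub hsV
    have hlin := hsum.mul_right (e * (W - V))
    have heq : (fun n : ℤ => besselJ n A ^ 2 * |e * W + n * ω| -
        besselJ n A ^ 2 * |e * V + n * ω|) =
        fun n : ℤ => besselJ n A ^ 2 * (if 0 < x + n then 1 else -1) * (e * (W - V)) := by
      ext n
      rw [hscale, hscale, hsign _ hW, hsign _ ⟨hlo, hhi⟩]
      have : ω * (reducedBias e h Ω W - x) = e * (W - V) := by
        rw [hxdef, reducedBias, reducedBias, ← hω]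
        field_simp
      rw [← this]
      ring
    rw [heq] at hdiff
    have := hdiff.unique hlin
    simp only [shotNoise, plateauSlope, ← hω]
    linear_combination (2 * e ^ 2 / h * T * (1 - T)) * this
  have hlinear : HasDerivAt
      (fun W => shotNoise e h Ω T A V + plateauSlope e h T * D * (W - V))
      (plateauSlope e h T * D) V := by
    simpa using (((hasDerivAt_id V).sub_const V).const_mul (plateauSlope e h T * D)).const_add
      (shotNoise e h Ω T A V)
  exact hlinear.congr_of_eventuallyEq hloc

theorem plateauDeficit_eq {e h Ω T A V : ℝ} (he : 0 < e) (hh : 0 < h) (hΩ : 0 < Ω)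
    (hV : OffStep e h Ω V) :
    plateauDeficit e h Ω T A V = (4 * e ^ 3 / h) * T * (1 - T) *
      discreteBesselKernel A (biasIndex e h Ω V) (biasIndex e h Ω V) := by
  rw [plateauDeficit, (hasDerivAt_shotNoise he hh hΩ hV).deriv, plateauSlope]
  ring

theorem tendsto_biasIndex_atTop {e h Ω : ℝ} (he : 0 < e) (hh : 0 < h) (hΩ : 0 < Ω) :
    Tendsto (biasIndex e h Ω) atTop atTop := by
  have hω0 : 0 < hbar h * Ω := mul_pos (hbar_pos hh) hΩ
  have h1 : Tendsto (reducedBias e h Ω) atTop atTop :=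
    (tendsto_id.const_mul_atTop he).atTop_div_const hω0
  exact tendsto_ceil_atTop.comp h1

theorem tendsto_deriv_shotNoise {e h Ω T A : ℝ} (he : 0 < e) (hh : 0 < h) (hΩ : 0 < Ω) :
    Tendsto (deriv (shotNoise e h Ω T A)) (atTop ⊓ 𝓟 {V : ℝ | OffStep e h Ω V})
      (𝓝 (plateauSlope e h T)) := by
  have h1 := (tendsto_discreteBesselKernel_atTop A).comp (tendsto_biasIndex_atTop he hh hΩ)
  have h2 := ((h1.const_mul 2).const_sub 1).const_mul (plateauSlope e h T)
  rw [mul_zero, sub_zero, mul_one] at h2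
  refine (h2.mono_left inf_le_left).congr' ?_
  filter_upwards [mem_inf_of_right (mem_principal_self _)] with V hV
  exact (hasDerivAt_shotNoise he hh hΩ hV).deriv.symm

/-! ### Contour shift and uniform Gaussian bound -/

-- Cauchy's theorem on a rectangle one period wide: the vertical sides cancel by periodicity.
open Complex in
theorem intervalIntegral_eq_integral_add_mul_I {f : ℂ → ℂ} (hf : Differentiable ℂ f)
    (hper : ∀ z, f (z + 2 * Real.pi) = f z) (η : ℝ) :
    ∫ θ in (-Real.pi)..Real.pi, f θ = ∫ θ in (-Real.pi)..Real.pi, f (θ + η * I) := by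
  have h := integral_boundary_rect_eq_zero_of_differentiableOn f (-Real.pi : ℝ)
    ((Real.pi : ℝ) + η * I) hf.differentiableOn
  have hside : ∀ y : ℝ, f ((Real.pi : ℝ) + y * I) = f ((-Real.pi : ℝ) + y * I) := by
    intro y
    rw [← hper ((-Real.pi : ℝ) + y * I)]
    congr 1
    push_cast
    ring
  simp only [ofReal_re, ofReal_im, add_re, add_im, mul_re, mul_im, I_re, I_im, mul_zero, mul_one,
    zero_mul, sub_zero, add_zero, zero_add, ofReal_zero, hside] at h
  rw [add_sub_cancel_right] at h
  exact sub_eq_zero.1 h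

/-- The integrand of `κ J_n(2κ³)` after shifting the contour to height `1 / κ` and rescaling by
`κ`, where `n = 2κ³ + tκ`. -/
noncomputable def edgeIntegrand (κ t φ : ℝ) : ℂ :=
  Complex.exp (Complex.I * (t * (φ + Complex.I) +
    2 * κ ^ 3 * ((φ + Complex.I) / κ - Complex.sin ((φ + Complex.I) / κ))))

theorem continuous_edgeIntegrand (κ t : ℝ) : Continuous (edgeIntegrand κ t) := by
  unfold edgeIntegrand
  fun_prop

theorem edgeScale_mul_besselJ {κ : ℝ} (hκ : 0 < κ) (n : ℤ) :
    ((κ * besselJ n (2 * κ ^ 3) : ℝ) : ℂ) = (1 / (2 * Real.pi) : ℂ) *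
      ∫ φ in (-(κ * Real.pi))..(κ * Real.pi), edgeIntegrand κ ((n - 2 * κ ^ 3) / κ) φ := by
  have hκ' : (κ : ℂ) ≠ 0 := by exact_mod_cast hκ.ne'
  have hshift := intervalIntegral_eq_integral_add_mul_I
    (f := fun z => Complex.exp (Complex.I * (n * z - (2 * κ ^ 3 : ℝ) * Complex.sin z)))
    (by fun_prop) (fun z => by
      have : Complex.I * (n * (z + 2 * Real.pi) -
          (2 * κ ^ 3 : ℝ) * Complex.sin (z + 2 * Real.pi)) =
          Complex.I * (n * z - (2 * κ ^ 3 : ℝ) * Complex.sin z) +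
            n * (2 * Real.pi * Complex.I) := by
        rw [Complex.sin_add_two_pi]; ring
      rw [this, Complex.exp_add, Complex.exp_int_mul_two_pi_mul_I, mul_one]) (1 / κ)
  have hscale := intervalIntegral.smul_integral_comp_mul_left (a := -Real.pi) (b := Real.pi)
    (edgeIntegrand κ ((n - 2 * κ ^ 3) / κ)) κ
  rw [mul_neg] at hscale
  rw [← hscale, Complex.ofReal_mul, ofReal_besselJ, hshift, mul_left_comm, ← Complex.coe_smul,
    smul_eq_mul]
  congr 2
  refine intervalIntegral.integral_congr fun θ _ => ?_
  simp only [edgeIntegrand]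
  have hz : ((κ * θ : ℝ) + Complex.I) / (κ : ℂ) = θ + (1 / κ : ℝ) * Complex.I := by
    push_cast
    field_simp
  rw [hz]
  congr 2
  push_cast
  field_simp
  ring

theorem sinh_le_add_cube {x : ℝ} (hx0 : 0 ≤ x) (hx1 : x ≤ 1) :
    Real.sinh x ≤ x + x ^ 3 / 4 := by
  have h := Complex.sin_bound (x := x * Complex.I)
    (by simpa [abs_of_nonneg hx0] using hx1)
  have heq : Complex.sin (x * Complex.I) - (x * Complex.I - (x * Complex.I) ^ 3 / 6) =
      ((Real.sinh x - (x + x ^ 3 / 6) : ℝ) : ℂ) * Complex.I := by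
    rw [Complex.sin_mul_I]
    push_cast
    linear_combination (x ^ 3 / 6 * Complex.I : ℂ) * Complex.I_sq
  rw [heq, norm_mul, Complex.norm_I, mul_one, Complex.norm_real, norm_mul, Complex.norm_I,
    Complex.norm_real, mul_one, Real.norm_eq_abs, Real.norm_eq_abs, abs_of_nonneg hx0] at h
  have h1 := (abs_le.1 h).2
  -- The Taylor remainder of sine at `ix`, of order `x⁵`, is absorbed in the gap between `x³/6` and
  -- `x³/4`.
  have h2 : x ^ 5 ≤ x ^ 3 := pow_le_pow_of_le_one hx0 hx1 (by norm_num)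
  have h3 : 0 ≤ x ^ 3 := by positivity
  linarith

/-- The exponent has real part `-t - 2κ³(1/κ - cos(φ/κ) sinh(1/κ))`. The quadratic bound on cosine
over `[-π, π]` gives the Gaussian, and the cubic term of sinh gives the `1/2`. -/
theorem norm_edgeIntegrand_le {κ : ℝ} (hκ : 1 ≤ κ) (t : ℝ) {φ : ℝ} (hφ : |φ| ≤ κ * Real.pi) :
    ‖edgeIntegrand κ t φ‖ ≤ Real.exp (1 / 2 - t) * Real.exp (-(4 / Real.pi ^ 2) * φ ^ 2) := by
  have hκ0 : 0 < κ := by linarith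
  have hκ' : (κ : ℂ) ≠ 0 := by exact_mod_cast hκ0.ne'
  have hz : ((φ : ℂ) + Complex.I) / κ = (φ / κ : ℝ) + (1 / κ : ℝ) * Complex.I := by
    push_cast
    field_simp
  have hre : (Complex.I * (t * (φ + Complex.I) +
      2 * κ ^ 3 * ((φ + Complex.I) / κ - Complex.sin ((φ + Complex.I) / κ)))).re =
      -(t + 2 * κ ^ 3 * (1 / κ - Real.cos (φ / κ) * Real.sinh (1 / κ))) := by
    rw [hz, Complex.sin_add_mul_I, ← Complex.ofReal_sin, ← Complex.ofReal_cos,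
      ← Complex.ofReal_sinh, ← Complex.ofReal_cosh]
    have : Complex.I * (t * (φ + Complex.I) +
      2 * κ ^ 3 * ((φ / κ : ℝ) + (1 / κ : ℝ) * Complex.I -
        ((Real.sin (φ / κ) : ℂ) * (Real.cosh (1 / κ) : ℂ) +
          (Real.cos (φ / κ) : ℂ) * (Real.sinh (1 / κ) : ℂ) * Complex.I))) =
      ((-(t + 2 * κ ^ 3 * (1 / κ - Real.cos (φ / κ) * Real.sinh (1 / κ))) : ℝ) : ℂ) +
      ((t * φ + 2 * κ ^ 3 * (φ / κ - Real.sin (φ / κ) * Real.cosh (1 / κ)) : ℝ) : ℂ) *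
        Complex.I := by
      push_cast
      linear_combination ((t : ℂ) + 2 * κ ^ 3 * (1 / κ -
        Complex.cos (φ / κ) * Complex.sinh (1 / κ))) * Complex.I_sq
    rw [this, Complex.add_re, Complex.re_ofReal_mul, Complex.I_re, mul_zero, add_zero,
      Complex.ofReal_re]
  rw [edgeIntegrand, Complex.norm_exp, hre, ← Real.exp_add, Real.exp_le_exp]
  have hη0 : 0 ≤ 1 / κ := by positivity
  have hη1 : 1 / κ ≤ 1 := by rw [div_le_one hκ0]; exact hκ
  have hcos : Real.cos (φ / κ) ≤ 1 - 2 / Real.pi ^ 2 * (φ / κ) ^ 2 := by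
    apply Real.cos_le_one_sub_mul_cos_sq
    rw [abs_div, abs_of_pos hκ0, div_le_iff₀ hκ0]
    linarith
  have hup := sinh_le_add_cube hη0 hη1
  have hlow : 1 / κ ≤ Real.sinh (1 / κ) := Real.self_le_sinh_iff.2 hη0
  have hmain : Real.cos (φ / κ) * Real.sinh (1 / κ) ≤
      1 / κ + (1 / κ) ^ 3 / 4 - 2 / Real.pi ^ 2 * (φ / κ) ^ 2 * (1 / κ) := by
    have h1 : 0 ≤ 2 / Real.pi ^ 2 * (φ / κ) ^ 2 := by positivity
    have h2 : Real.cos (φ / κ) * Real.sinh (1 / κ) ≤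
        (1 - 2 / Real.pi ^ 2 * (φ / κ) ^ 2) * Real.sinh (1 / κ) :=
      mul_le_mul_of_nonneg_right hcos (hη0.trans hlow)
    have h3 := mul_le_mul_of_nonneg_left hlow h1
    linarith
  have hfin : 2 * κ ^ 3 * (Real.cos (φ / κ) * Real.sinh (1 / κ)) ≤
      2 * κ ^ 3 * (1 / κ + (1 / κ) ^ 3 / 4 - 2 / Real.pi ^ 2 * (φ / κ) ^ 2 * (1 / κ)) :=
    mul_le_mul_of_nonneg_left hmain (by positivity)
  have heval : 2 * κ ^ 3 * (1 / κ + (1 / κ) ^ 3 / 4 -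
      2 / Real.pi ^ 2 * (φ / κ) ^ 2 * (1 / κ)) =
      2 * κ ^ 3 * (1 / κ) + 1 / 2 - 4 / Real.pi ^ 2 * φ ^ 2 := by
    have := Real.pi_ne_zero
    field_simp
    ring
  linarith

theorem integrable_exp_neg_four_div_pi_sq :
    Integrable fun φ : ℝ => Real.exp (-(4 / Real.pi ^ 2) * φ ^ 2) :=
  integrable_exp_neg_mul_sq (by positivity)

/-! ### The Airy limit at the edge -/

theorem tendsto_edgeIntegrand {ι : Type*} {l : Filter ι} {κ t : ι → ℝ} {x : ℝ}
    (hκ : Tendsto κ l atTop) (ht : Tendsto t l (𝓝 x)) (φ : ℝ) :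
    Tendsto (fun i => edgeIntegrand (κ i) (t i) φ) l
      (𝓝 (Complex.exp (Complex.I *
        (((φ : ℂ) + Complex.I) ^ 3 / 3 + (x : ℂ) * ((φ : ℂ) + Complex.I))))) := by
  set z : ℂ := (φ : ℂ) + Complex.I with hz
  have hinv : Tendsto (fun i => ‖z‖ / κ i) l (𝓝 0) := hκ.const_div_atTop ‖z‖
  have hcube : Tendsto (fun i => 2 * (κ i : ℂ) ^ 3 * (z / κ i - Complex.sin (z / κ i))) l
      (𝓝 (z ^ 3 / 3)) := by
    rw [tendsto_iff_norm_sub_tendsto_zero]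
    have hbd : Tendsto (fun i => ‖z‖ ^ 3 / 50 * (‖z‖ / κ i) ^ 2) l (𝓝 0) := by
      simpa using (hinv.pow 2).const_mul (‖z‖ ^ 3 / 50)
    refine squeeze_zero' (Eventually.of_forall fun _ => norm_nonneg _) ?_ hbd
    filter_upwards [hκ.eventually_gt_atTop 0, hinv.eventually (gt_mem_nhds one_pos)] with i h0 h1
    have hκ' : (κ i : ℂ) ≠ 0 := by exact_mod_cast h0.ne'
    have hn : ‖z / (κ i : ℂ)‖ = ‖z‖ / κ i := by
      rw [norm_div, Complex.norm_real, Real.norm_of_nonneg h0.le]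
    have hsin := Complex.sin_bound (x := z / κ i) (by rw [hn]; exact h1.le)
    have heq : 2 * (κ i : ℂ) ^ 3 * (z / κ i - Complex.sin (z / κ i)) - z ^ 3 / 3 =
        -(2 * (κ i : ℂ) ^ 3) * (Complex.sin (z / κ i) - (z / κ i - (z / κ i) ^ 3 / 6)) := by
      field_simp
      ring
    rw [heq, norm_mul, norm_neg, norm_mul, norm_pow, Complex.norm_real,
      Real.norm_of_nonneg h0.le, Complex.norm_ofNat]
    rw [hn] at hsin
    calc 2 * κ i ^ 3 * _ ≤ 2 * κ i ^ 3 * ((‖z‖ / κ i) ^ 5 / 100) := by gcongr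
      _ = _ := by field_simp; ring
  have ht' : Tendsto (fun i => ((t i : ℝ) : ℂ)) l (𝓝 (x : ℂ)) :=
    (Complex.continuous_ofReal.tendsto x).comp ht
  have hsum := ((ht'.mul_const z).add hcube).const_mul Complex.I
  rw [add_comm (_ ^ 3 / 3)]
  exact (Complex.continuous_exp.tendsto _).comp hsum

/-- At the edge `n = A + t κ`, `A = 2κ³`, the Bessel functions scale to the Airy function. -/
theorem tendsto_edgeScale_mul_besselJ {ι : Type*} {l : Filter ι} [l.IsCountablyGenerated]
    {κ : ι → ℝ} {n : ι → ℤ} {x : ℝ} (hκ : Tendsto κ l atTop)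
    (hn : Tendsto (fun i => ((n i : ℝ) - 2 * κ i ^ 3) / κ i) l (𝓝 x)) :
    Tendsto (fun i => κ i * besselJ (n i) (2 * κ i ^ 3)) l (𝓝 (airyAi x)) := by
  set t : ι → ℝ := fun i => ((n i : ℝ) - 2 * κ i ^ 3) / κ i with ht
  set S : ι → Set ℝ := fun i => Set.Ioc (-(κ i * Real.pi)) (κ i * Real.pi) with hS
  have hlim : Tendsto (fun i => ∫ φ, (S i).indicator (edgeIntegrand (κ i) (t i)) φ) l
      (𝓝 (∫ φ : ℝ, Complex.exp (Complex.I *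
        (((φ : ℂ) + Complex.I) ^ 3 / 3 + (x : ℂ) * ((φ : ℂ) + Complex.I))))) := by
    refine tendsto_integral_filter_of_dominated_convergence
      -- Eventually `t i > x - 1`, which makes the majorant independent of `i`.
      (fun φ => Real.exp (1 / 2 - (x - 1)) * Real.exp (-(4 / Real.pi ^ 2) * φ ^ 2)) ?_ ?_ ?_ ?_
    · exact Eventually.of_forall fun i =>
        ((continuous_edgeIntegrand _ _).stronglyMeasurable.indicator
          measurableSet_Ioc).aestronglyMeasurable
    · filter_upwards [hκ.eventually_ge_atTop 1,
        hn.eventually (lt_mem_nhds (sub_one_lt x))] with i h1 h2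
      refine ae_of_all _ fun φ => ?_
      by_cases hφ : φ ∈ S i
      · rw [Set.indicator_of_mem hφ]
        refine (norm_edgeIntegrand_le h1 (t i) (abs_le.2 ⟨hφ.1.le, hφ.2⟩)).trans ?_
        gcongr
      · rw [Set.indicator_of_notMem hφ, norm_zero]
        positivity
    · exact integrable_exp_neg_four_div_pi_sq.const_mul _
    · refine ae_of_all _ fun φ => (tendsto_edgeIntegrand hκ hn φ).congr' ?_
      filter_upwards [hκ.eventually_gt_atTop (|φ| / Real.pi)] with i hi
      rw [div_lt_iff₀ Real.pi_pos, abs_lt] at hi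
      rw [Set.indicator_of_mem]
      exact ⟨hi.1, hi.2.le⟩
  have hre := (Complex.continuous_re.tendsto _).comp
    (hlim.const_mul (1 / (2 * Real.pi) : ℂ))
  refine hre.congr' ?_
  filter_upwards [hκ.eventually_gt_atTop 0] with i hi
  have h := edgeScale_mul_besselJ hi (n i)
  have hle : -(κ i * Real.pi) ≤ κ i * Real.pi := by
    have := Real.pi_pos
    have : 0 < κ i * Real.pi := by positivity
    linarith
  rw [intervalIntegral.integral_of_le hle, ← integral_indicator measurableSet_Ioc] at h
  simp only [Function.comp]
  rw [← h, Complex.ofReal_re]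

theorem exists_abs_edgeScale_mul_besselJ_le :
    ∃ C : ℝ, 0 ≤ C ∧ ∀ κ : ℝ, 1 ≤ κ → ∀ n : ℤ,
      |κ * besselJ n (2 * κ ^ 3)| ≤ C * Real.exp (-((n - 2 * κ ^ 3) / κ)) := by
  set G := ∫ φ : ℝ, Real.exp (-(4 / Real.pi ^ 2) * φ ^ 2) with hG
  have hG0 : 0 ≤ G := integral_nonneg fun φ => (Real.exp_pos _).le
  refine ⟨1 / (2 * Real.pi) * Real.exp (1 / 2) * G, by positivity, fun κ hκ n => ?_⟩
  have hπ := Real.pi_pos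
  set t := ((n : ℝ) - 2 * κ ^ 3) / κ with ht
  have hle : -(κ * Real.pi) ≤ κ * Real.pi := by
    have : 0 < κ * Real.pi := by positivity
    linarith
  rw [← Real.norm_eq_abs, ← Complex.norm_real, edgeScale_mul_besselJ (by linarith) n, ← ht,
    intervalIntegral.integral_of_le hle, norm_mul]
  have hint : ‖∫ φ in Set.Ioc (-(κ * Real.pi)) (κ * Real.pi), edgeIntegrand κ t φ‖ ≤
      Real.exp (1 / 2 - t) * G := by
    calc _ ≤ ∫ φ in Set.Ioc (-(κ * Real.pi)) (κ * Real.pi),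
          Real.exp (1 / 2 - t) * Real.exp (-(4 / Real.pi ^ 2) * φ ^ 2) := by
          refine norm_integral_le_of_norm_le
            (integrable_exp_neg_four_div_pi_sq.const_mul _).integrableOn ?_
          filter_upwards [ae_restrict_mem measurableSet_Ioc] with φ hφ
          exact norm_edgeIntegrand_le hκ t (abs_le.2 ⟨hφ.1.le, hφ.2⟩)
      _ ≤ ∫ φ, Real.exp (1 / 2 - t) * Real.exp (-(4 / Real.pi ^ 2) * φ ^ 2) :=
          setIntegral_le_integral (integrable_exp_neg_four_div_pi_sq.const_mul _)
            (ae_of_all _ fun φ => by positivity)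
      _ = _ := integral_const_mul _ _
  have hnorm : ‖(1 / (2 * Real.pi) : ℂ)‖ = 1 / (2 * Real.pi) := by
    rw [show (1 / (2 * Real.pi) : ℂ) = ((1 / (2 * Real.pi) : ℝ) : ℂ) by push_cast; rfl,
      Complex.norm_real, Real.norm_of_nonneg (by positivity)]
  rw [hnorm]
  calc _ ≤ 1 / (2 * Real.pi) * (Real.exp (1 / 2 - t) * G) := by gcongr
    _ = _ := by
      rw [show 1 / 2 - t = 1 / 2 + -t by ring, Real.exp_add]
      ring

theorem tendsto_floor_edge {ι : Type*} {l : Filter ι} {κ : ι → ℝ} (hκ : Tendsto κ l atTop)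
    (s : ℝ) :
    Tendsto (fun i => ((⌊2 * κ i ^ 3 + s * κ i⌋ : ℝ) - 2 * κ i ^ 3) / κ i) l (𝓝 s) := by
  have hlow : Tendsto (fun i => s - 1 / κ i) l (𝓝 s) := by
    simpa using (hκ.const_div_atTop (1 : ℝ)).const_sub s
  refine tendsto_of_tendsto_of_tendsto_of_le_of_le' hlow tendsto_const_nhds ?_ ?_
  · filter_upwards [hκ.eventually_gt_atTop 0] with i hi
    have h := Int.sub_one_lt_floor (2 * κ i ^ 3 + s * κ i)
    rw [le_div_iff₀ hi, sub_mul, div_mul_cancel₀ _ hi.ne']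
    linarith
  · filter_upwards [hκ.eventually_gt_atTop 0] with i hi
    have h := Int.floor_le (2 * κ i ^ 3 + s * κ i)
    rw [div_le_iff₀ hi]
    linarith

/-- Measurability passes to the pointwise limit from the rescaled Bessel step functions. -/
theorem measurable_airyAi : Measurable airyAi := by
  refine measurable_of_tendsto_metrizable (f := fun (m : ℕ) (x : ℝ) =>
    (m : ℝ) * besselJ ⌊2 * (m : ℝ) ^ 3 + x * m⌋ (2 * (m : ℝ) ^ 3)) (fun m => ?_) ?_
  · have h1 : Measurable fun n : ℤ => (m : ℝ) * besselJ n (2 * (m : ℝ) ^ 3) :=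
      measurable_from_top
    exact h1.comp (Int.measurable_floor.comp (by fun_prop))
  · exact tendsto_pi_nhds.2 fun x =>
      tendsto_edgeScale_mul_besselJ tendsto_natCast_atTop_atTop
        (tendsto_floor_edge tendsto_natCast_atTop_atTop x)

/-- The uniform Bessel bound survives the edge limit. -/
theorem exists_abs_airyAi_le : ∃ C : ℝ, 0 ≤ C ∧ ∀ x : ℝ, |airyAi x| ≤ C * Real.exp (-x) := by
  obtain ⟨C, hC0, hC⟩ := exists_abs_edgeScale_mul_besselJ_le
  refine ⟨C, hC0, fun x => ?_⟩
  have hfl := tendsto_floor_edge (tendsto_id (α := ℝ) (x := atTop)) x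
  have h1 := (tendsto_edgeScale_mul_besselJ tendsto_id hfl).abs
  have h2 := ((Real.continuous_exp.tendsto _).comp hfl.neg).const_mul C
  refine le_of_tendsto_of_tendsto h1 h2 ?_
  filter_upwards [eventually_ge_atTop 1] with κ hκ
  exact hC κ hκ _

theorem integrableOn_exp_neg_two_mul_add (c : ℝ) :
    IntegrableOn (fun u : ℝ => Real.exp (-2 * (u + c))) (Set.Ioi 0) := by
  have h : IntegrableOn (fun u : ℝ => Real.exp (-2 * c) * Real.exp (-2 * u)) (Set.Ioi 0) :=
    (integrableOn_exp_mul_Ioi (a := -2) (by norm_num) 0).const_mul (Real.exp (-2 * c))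
  refine h.congr_fun (fun u _ => ?_) measurableSet_Ioi
  beta_reduce
  rw [← Real.exp_add]
  ring_nf

theorem integrableOn_airyAi_mul_airyAi (s : ℝ) :
    IntegrableOn (fun u : ℝ => airyAi (s + u) * airyAi (s + u)) (Set.Ioi 0) := by
  obtain ⟨C, hC0, hC⟩ := exists_abs_airyAi_le
  have hm : Measurable fun u : ℝ => airyAi (s + u) :=
    measurable_airyAi.comp (measurable_const_add s)
  refine ((integrableOn_exp_neg_two_mul_add s).const_mul (C ^ 2)).mono'
    (hm.mul hm).aestronglyMeasurable (ae_of_all _ fun u => ?_)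
  rw [Real.norm_eq_abs, abs_mul]
  calc _ ≤ (C * Real.exp (-(s + u))) * (C * Real.exp (-(s + u))) := by gcongr <;> exact hC _
    _ = C ^ 2 * (Real.exp (-(s + u)) * Real.exp (-(s + u))) := by ring
    _ = _ := by rw [← Real.exp_add]; ring_nf

/-! ### From the discrete Bessel kernel to the Airy kernel -/

theorem setIntegral_comp_floor {a : ℕ → ℝ} (ha : Summable fun r => |a r|) :
    ∫ x in Set.Ioi (0 : ℝ), a ⌊x⌋₊ = ∑' r, a r := by
  have hU : ⋃ r : ℕ, Set.Ico (r : ℝ) (r + 1) = Set.Ici 0 := by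
    ext x
    simp only [Set.mem_iUnion, Set.mem_Ico, Set.mem_Ici]
    constructor
    · rintro ⟨r, hr, -⟩
      exact (Nat.cast_nonneg r).trans hr
    · intro hx
      exact ⟨⌊x⌋₊, Nat.floor_le hx, Nat.lt_floor_add_one x⟩
  have hdis : Pairwise (Function.onFun Disjoint fun r : ℕ => Set.Ico (r : ℝ) (r + 1)) := by
    intro i j hij
    refine Set.disjoint_left.2 fun x hi hj => hij ?_
    rw [← Nat.floor_eq_on_Ico i x hi, ← Nat.floor_eq_on_Ico j x hj]
  have hconst : ∀ (b : ℕ → ℝ) (r : ℕ),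
      Set.EqOn (fun x : ℝ => b ⌊x⌋₊) (fun _ => b r) (Set.Ico (r : ℝ) (r + 1)) := by
    intro b r x hx
    simp only [Nat.floor_eq_on_Ico r x hx]
  have hval : ∀ (b : ℕ → ℝ) (r : ℕ), ∫ x in Set.Ico (r : ℝ) (r + 1), b ⌊x⌋₊ = b r := by
    intro b r
    rw [setIntegral_congr_fun measurableSet_Ico (hconst b r)]
    simp
  have hon : ∀ r : ℕ, IntegrableOn (fun x : ℝ => a ⌊x⌋₊) (Set.Ico (r : ℝ) (r + 1)) := by
    intro r
    refine IntegrableOn.congr_fun ?_ (hconst a r).symm measurableSet_Ico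
    exact integrableOn_const (by simp)
  have hint : IntegrableOn (fun x : ℝ => a ⌊x⌋₊) (⋃ r : ℕ, Set.Ico (r : ℝ) (r + 1)) := by
    refine integrableOn_iUnion_of_summable_integral_norm hon ?_
    simp only [Real.norm_eq_abs]
    simpa only [hval fun r => |a r|] using ha
  rw [← integral_Ici_eq_integral_Ioi, ← hU]
  rw [integral_iUnion (fun _ => measurableSet_Ico) hdis hint]
  exact tsum_congr fun r => hval a r

theorem edgeScale_mul_discreteBesselKernel {κ : ℝ} (hκ : 0 < κ) (A : ℝ) (ν : ℤ) :
    κ * discreteBesselKernel A ν ν =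
      ∫ u in Set.Ioi (0 : ℝ), (κ * besselJ (ν + ⌊κ * u⌋₊) A) ^ 2 := by
  have h1 : Summable fun r : ℕ => |besselJ (ν + r) A ^ 2| := by
    simpa only [abs_sq] using summable_besselJ_shift_sq A ν
  have h2 := integral_comp_mul_left_Ioi (fun x : ℝ => besselJ (ν + ⌊x⌋₊) A ^ 2) 0 hκ
  rw [mul_zero, setIntegral_comp_floor h1, ← discreteBesselKernel_self, smul_eq_mul] at h2
  simp only [mul_pow]
  rw [integral_const_mul, h2]
  field_simp

theorem tendsto_edgeScale_mul_discreteBesselKernel {ι : Type*} {l : Filter ι}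
    [l.IsCountablyGenerated] {κ : ι → ℝ} (hκ : Tendsto κ l atTop) (s : ℝ) :
    Tendsto (fun i => κ i * discreteBesselKernel (2 * κ i ^ 3) ⌊2 * κ i ^ 3 + s * κ i⌋
      ⌊2 * κ i ^ 3 + s * κ i⌋) l (𝓝 (airyKernel s s)) := by
  obtain ⟨C, hC0, hC⟩ := exists_abs_edgeScale_mul_besselJ_le
  set ν : ι → ℤ := fun i => ⌊2 * κ i ^ 3 + s * κ i⌋ with hν
  have hlim : Tendsto (fun i => ∫ u in Set.Ioi (0 : ℝ),
      (κ i * besselJ (ν i + ⌊κ i * u⌋₊) (2 * κ i ^ 3)) ^ 2) l (𝓝 (airyKernel s s)) := by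
    refine tendsto_integral_filter_of_dominated_convergence
      -- The two floors lose less than `1` each; after division by `κ ≥ 1` the total loss is below
      -- `2`.
      (fun u => C ^ 2 * Real.exp (-2 * (u + (s - 2)))) ?_ ?_ ?_ ?_
    · refine Eventually.of_forall fun i => Measurable.aestronglyMeasurable ?_
      have h1 : Measurable fun r : ℕ => (κ i * besselJ (ν i + r) (2 * κ i ^ 3)) ^ 2 :=
        measurable_from_top
      exact h1.comp (Nat.measurable_floor.comp (measurable_const_mul (κ i)))
    · filter_upwards [hκ.eventually_ge_atTop 1] with i hi
      refine ae_of_all _ fun u => ?_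
      rw [Real.norm_eq_abs, abs_pow]
      have hi0 : 0 < κ i := by linarith
      have hexp : u + (s - 2) ≤ (((ν i + ⌊κ i * u⌋₊ : ℤ) : ℝ) - 2 * κ i ^ 3) / κ i := by
        rw [le_div_iff₀ hi0]
        have h1 := Int.sub_one_lt_floor (2 * κ i ^ 3 + s * κ i)
        have h2 := Nat.sub_one_lt_floor (κ i * u)
        push_cast
        simp only [hν]
        nlinarith
      calc _ ≤ (C * Real.exp (-(u + (s - 2)))) ^ 2 := by
            gcongr
            refine (hC (κ i) hi _).trans ?_
            gcongr
        _ = C ^ 2 * (Real.exp (-(u + (s - 2))) * Real.exp (-(u + (s - 2)))) := by ring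
        _ = _ := by rw [← Real.exp_add]; ring_nf
    · exact (integrableOn_exp_neg_two_mul_add _).const_mul _
    · filter_upwards [ae_restrict_mem measurableSet_Ioi] with u hu
      rw [← sq]
      refine (tendsto_edgeScale_mul_besselJ hκ ?_).pow 2
      have hfl : Tendsto (fun i => (⌊κ i * u⌋₊ : ℝ) / κ i) l (𝓝 u) := by
        refine (((tendsto_nat_floor_mul_div_atTop (R := ℝ) (le_of_lt hu)).comp hκ)).congr
          fun i => ?_
        simp only [Function.comp, mul_comm]
      refine ((tendsto_floor_edge hκ s).add hfl).congr fun i => ?_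
      push_cast
      ring
  refine hlim.congr' ?_
  filter_upwards [hκ.eventually_gt_atTop 0] with i hi
  exact (edgeScale_mul_discreteBesselKernel hi _ _).symm

theorem two_mul_edgeScale_pow {A : ℝ} (hA : 0 ≤ A) : 2 * edgeScale A ^ 3 = A := by
  rw [edgeScale, ← Real.rpow_natCast, ← Real.rpow_mul (by positivity)]
  norm_num
  ring

theorem tendsto_edgeScale_atTop : Tendsto edgeScale atTop atTop :=
  (tendsto_rpow_atTop (by norm_num)).comp (tendsto_id.atTop_div_const two_pos)

theorem tendsto_edgeScale_mul_plateauDeficit {e h Ω T : ℝ} (he : 0 < e) (hh : 0 < h)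
    (hΩ : 0 < Ω) {s : ℝ} {V : ℝ → ℝ}
    (hV : ∀ᶠ A in atTop, OffStep e h Ω (V A) ∧ biasIndex e h Ω (V A) = edgeIndex A s) :
    Tendsto (fun A : ℝ => edgeScale A * plateauDeficit e h Ω T A (V A)) atTop
      (𝓝 ((4 * e ^ 3 / h) * T * (1 - T) * airyKernel s s)) := by
  refine ((tendsto_edgeScale_mul_discreteBesselKernel tendsto_edgeScale_atTop s).const_mul
    ((4 * e ^ 3 / h) * T * (1 - T))).congr' ?_
  filter_upwards [hV, eventually_ge_atTop 0] with A hA hA0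
  rw [plateauDeficit_eq he hh hΩ hA.1, hA.2, edgeIndex, two_mul_edgeScale_pow hA0]
  ring

end ShotNoise

theorem mainTheorem2 (e h Ω T : ℝ) (he : 0 < e) (hh : 0 < h) (hΩ : 0 < Ω)
    (hT₀ : 0 ≤ T) (hT₁ : T ≤ 1) :
    (∀ A : ℝ, 0 ≤ A →
      (∀ V : ℝ, Summable fun n : ℤ =>
        ShotNoise.besselJ n A ^ 2 * |e * V + n * (ShotNoise.hbar h * Ω)|) ∧
      (∀ ν l : ℤ, Summable fun r : ℕ =>
        ShotNoise.besselJ (ν + r) A * ShotNoise.besselJ (l + r) A) ∧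
      (∀ V : ℝ, 0 < V → ShotNoise.OffStep e h Ω V →
        DifferentiableAt ℝ (ShotNoise.shotNoise e h Ω T A) V ∧
        ShotNoise.plateauDeficit e h Ω T A V =
          (4 * e ^ 3 / h) * T * (1 - T) *
            ShotNoise.discreteBesselKernel A
              (ShotNoise.biasIndex e h Ω V) (ShotNoise.biasIndex e h Ω V)) ∧
      Tendsto (deriv (ShotNoise.shotNoise e h Ω T A))
        (atTop ⊓ 𝓟 {V : ℝ | ShotNoise.OffStep e h Ω V})
        (𝓝 (ShotNoise.plateauSlope e h T))) ∧
    (∀ s : ℝ,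
      IntegrableOn (fun u : ℝ => ShotNoise.airyAi (s + u) * ShotNoise.airyAi (s + u))
        (Set.Ioi 0) ∧
      ∀ V : ℝ → ℝ,
        (∀ᶠ A in atTop, ShotNoise.OffStep e h Ω (V A) ∧
          ShotNoise.biasIndex e h Ω (V A) = ShotNoise.edgeIndex A s) →
        Tendsto (fun A : ℝ =>
            ShotNoise.edgeScale A * ShotNoise.plateauDeficit e h Ω T A (V A))
          atTop
          (𝓝 ((4 * e ^ 3 / h) * T * (1 - T) * ShotNoise.airyKernel s s))) := by
  refine ⟨fun A _ => ⟨fun V => ShotNoise.summable_besselJ_sq_mul_abs A _ _,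
    ShotNoise.summable_besselJ_mul_besselJ A, fun V _ hV =>
      ⟨(ShotNoise.hasDerivAt_shotNoise he hh hΩ hV).differentiableAt,
        ShotNoise.plateauDeficit_eq he hh hΩ hV⟩,
    ShotNoise.tendsto_deriv_shotNoise he hh hΩ⟩, fun s =>
      ⟨ShotNoise.integrableOn_airyAi_mul_airyAi s, fun V hV =>
        ShotNoise.tendsto_edgeScale_mul_plateauDeficit he hh hΩ hV⟩⟩
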